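/- Let $\Omega$ be a signature (functional symbols, including constants, and predicate symbols of finite arities) that contains a functional symbol of arity $\ge 1$. Let $\mathcal C$ be the class of all models of $\Omega$ (nonempty $\Omega$-structures), and write $\mathfrak A\ge\mathfrak B$ if $\mathfrak B$ is, up to isomorphism, a quotient $\mathfrak A/\theta$ of $\mathfrak A$ by a congruence $\theta$ (an equivalence relation compatible with all functional symbols; a predicate $P$ holds in $\mathfrak A/\theta$ of a tuple of classes iff it holds in $\mathfrak A$ of some tuple of representatives of them). Then the robust theory of $(\mathcal C,\ge)$ is $\mathrm{S4.2.1}$. Here the notions are as follows. *Modal logics.* Modal formulas are built from propositional variables $p_0,p_1,\dots$ by $\bot,\to,\Diamond$, and $\Box$ is $\neg\Diamond\neg$. A normal modal logic is a set of modal formulas that contains all classical tautologies, $\neg\Diamond\bot$ and $\Diamond(p\vee q)\to\Diamond p\vee\Diamond q$, and is closed under modus ponens, substitution, and the rule $\varphi\to\psi\,/\,\Diamond\varphi\to\Diamond\psi$. $\mathrm{S4}$ is the smallest one containing $\Diamond\Diamond p\to\Diamond p$ and $p\to\Diamond p$; $\mathrm{S4.2.1}$ is the smallest one including $\mathrm{S4}$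 and containing $\Box\Diamond p\leftrightarrow\Diamond\Box p$. *Languages.* A (model-theoretic) language $L$ based on $\Omega$ is a set of sentences with a satisfaction relation between models of $\Omega$ and these sentences that is preserved under isomorphisms, includes finitary first-order logic over $\Omega$, and is closed under Boolean connectives. $L\subseteq K$ means that every sentence of $L$ is a sentence of $K$, with the same satisfaction. *Modal theories.* Let $K_\Diamond$ be the set of expressions built from sentences of $K$ by Boolean connectives and $\Diamond$, where $\mathfrak A\models\Diamond\varphi$ iff $\mathfrak B\models\varphi$ for some $\mathfrak B\in\mathcal C$ with $\mathfrak A\ge\mathfrak B$. The modal theory $\mathrm{MTh}^K(\mathcal C,\ge)$ is the set of modal formulas that turn into expressions true in all models from $\mathcal C$ under every replacement of the propositional variables by elements of $K_\Diamond$ (equivalently, the modal logic of the Lindenbaum algebra of $K_\Diamond$ on $\mathcal C$). $\mathrm{MTh}^L(\mathcal C,\ge)$ is robust if $\mathrm{MTh}^K(\mathcal C,\ge)=\mathrm{MTh}^L(\mathcal C,\ge)$ for every language $K\supseteq L$. The assertion is thus: there is a language $L$ based on $\Omega$ such that $\mathrm{MTh}^L(\mathcal C,\ge)$ is robust, and for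 every such $L$ one has $\mathrm{MTh}^L(\mathcal C,\ge)=\mathrm{S4.2.1}$. -/

import Mathlib

open FirstOrder

universe u v w

/-! ### Modal formulas and normal modal logics -/

/-- Modal formulas over a set `V` of atoms, with `⊥`, `→`, `◇` as basic connectives. -/
inductive ModalFormula (V : Type w) : Type w
  | var : V → ModalFormula V
  | bot : ModalFormula V
  | imp : ModalFormula V → ModalFormula V → ModalFormula V
  | dia : ModalFormula V → ModalFormula V

namespace ModalFormula

variable {V : Type w}

def neg (φ : ModalFormula V) : ModalFormula V := imp φ bot

def or (φ ψ : ModalFormula V) : ModalFormula V := imp (neg φ) ψ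

def and (φ ψ : ModalFormula V) : ModalFormula V := neg (imp φ (neg ψ))

def iff (φ ψ : ModalFormula V) : ModalFormula V := and (imp φ ψ) (imp ψ φ)

/-- `□φ` abbreviates `¬◇¬φ`. -/
def box (φ : ModalFormula V) : ModalFormula V := neg (dia (neg φ))

/-- Simultaneous replacement of the atoms by modal formulas. -/
def subst {V' : Type v} (σ : V → ModalFormula V') : ModalFormula V → ModalFormula V'
  | var p => σ p
  | bot => bot
  | imp φ ψ => imp (subst σ φ) (subst σ ψ)
  | dia φ => dia (subst σ φ)

/-- Classical tautologies: formulas that are true under every truth assignment to all formulas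
that respects `⊥` and `→` (atoms and formulas `◇ψ` get arbitrary values). -/
def IsTautology (φ : ModalFormula V) : Prop :=
  ∀ e : ModalFormula V → Prop, ¬ e bot → (∀ χ ψ, e (imp χ ψ) ↔ (e χ → e ψ)) → e φ

end ModalFormula

/-- Propositional modal formulas: the propositional variables are indexed by `ℕ`. -/
abbrev MF : Type := ModalFormula ℕ

namespace MF

open ModalFormula

/-- The variable `p`. -/
def p : MF := var 0

/-- The variable `q`. -/
def q : MF := var 1

end MF

open ModalFormula MF in
/-- Normal (propositional, unimodal) modal logics. -/
structure IsNormalLogic (Λ : Set MF) : Prop where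
  tautology : ∀ φ : MF, φ.IsTautology → φ ∈ Λ
  dia_bot : neg (dia bot) ∈ Λ
  dia_or : imp (dia (or p q)) (or (dia p) (dia q)) ∈ Λ
  modus_ponens : ∀ φ ψ : MF, φ ∈ Λ → imp φ ψ ∈ Λ → ψ ∈ Λ
  substitution : ∀ (φ : MF) (σ : ℕ → MF), φ ∈ Λ → φ.subst σ ∈ Λ
  monotonicity : ∀ φ ψ : MF, imp φ ψ ∈ Λ → imp (dia φ) (dia ψ) ∈ Λ

/-- The smallest normal modal logic that includes `Γ`. -/
def smallestLogic (Γ : Set MF) : Set MF := {φ | ∀ Λ : Set MF, IsNormalLogic Λ → Γ ⊆ Λ → φ ∈ Λ}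

open ModalFormula MF in
/-- `S4`: the smallest normal logic containing `◇◇p → ◇p` and `p → ◇p`. -/
def logicS4 : Set MF := smallestLogic {imp (dia (dia p)) (dia p), imp p (dia p)}

open ModalFormula MF in
/-- `S4.2.1`: `S4 + (□◇p ↔ ◇□p)`. -/
def logicS421 : Set MF := smallestLogic (logicS4 ∪ {iff (box (dia p)) (dia (box p))})

/-! ### Models and quotients -/

/-- Models of the signature `Ω`: the nonempty `Ω`-structures. -/
abbrev OmegaModel (Ω : FirstOrder.Language.{u, v}) : Type (max u v (w + 1)) :=
  FirstOrder.Language.Theory.ModelType.{u, v, w} (∅ : Ω.Theory)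

/-- A congruence of an `Ω`-structure: an equivalence relation compatible with all functional
symbols of `Ω` (nothing is required for the predicate symbols). -/
structure ModelCongruence (Ω : FirstOrder.Language.{u, v}) (A : Type w) [Ω.Structure A] extends Setoid A where
  funMap_rel : ∀ {n : ℕ} (f : Ω.Functions n) (x y : Fin n → A),
    (∀ i, r (x i) (y i)) → r (FirstOrder.Language.Structure.funMap f x) (FirstOrder.Language.Structure.funMap f y)

namespace ModelCongruence

variable {Ω : FirstOrder.Language.{u, v}} {A : Type w} [Ω.Structure A]

/-- The universe of the quotient `A/θ`: the set of `θ`-classes. -/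
def Quot (θ : ModelCongruence Ω A) : Type w := Quotient θ.toSetoid

/-- The `θ`-class of an element. -/
def cls (θ : ModelCongruence Ω A) (a : A) : θ.Quot := Quotient.mk θ.toSetoid a

theorem cls_eq_cls (θ : ModelCongruence Ω A) (a b : A) : θ.cls a = θ.cls b ↔ θ.r a b :=
  Quotient.eq (r := θ.toSetoid)

theorem cls_surjective (θ : ModelCongruence Ω A) : Function.Surjective θ.cls :=
  Quotient.mk_surjective

/-- The quotient structure on `A/θ`: operations are computed on representatives; a predicate holds
of some classes iff it holds of some representatives of them. -/
noncomputable instance quotStructure (θ : ModelCongruence Ω A) : Ω.Structure θ.Quot where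
  funMap f x :=
    θ.cls (FirstOrder.Language.Structure.funMap f fun i => Function.surjInv θ.cls_surjective (x i))
  RelMap P x := ∃ a : Fin _ → A,
    (∀ i, θ.cls (a i) = x i) ∧ FirstOrder.Language.Structure.RelMap P a

/-- The operations of the quotient do not depend on the choice of representatives. -/
theorem funMap_cls (θ : ModelCongruence Ω A) {n : ℕ} (f : Ω.Functions n) (a : Fin n → A) :
    FirstOrder.Language.Structure.funMap f (fun i => θ.cls (a i)) =
      θ.cls (FirstOrder.Language.Structure.funMap f a) :=
  (θ.cls_eq_cls _ _).2 <| θ.funMap_rel f _ _ fun i =>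
    (θ.cls_eq_cls _ _).1 (Function.surjInv_eq θ.cls_surjective (θ.cls (a i)))

end ModelCongruence

/-- `A ≥ B`: the model `B` is (up to isomorphism) a quotient of the model `A`. -/
def QuotientRel {Ω : FirstOrder.Language.{u, v}} (A B : OmegaModel.{u, v, w} Ω) : Prop :=
  ∃ θ : ModelCongruence Ω A, Nonempty (θ.Quot ≃[Ω] B)

/-! ### Model-theoretic languages, modal theories and robustness -/

/-- A model-theoretic language based on `Ω`: a set of sentences with a satisfaction relation on
the models of `Ω` that is preserved under isomorphisms, includes the finitary first-order language
of `Ω`, and is closed under the Boolean connectives (`⊥` is a first-order sentence). -/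
structure ModelLanguage (Ω : FirstOrder.Language.{u, v}) where
  Sentence : Type (max u v w)
  Sat : OmegaModel.{u, v, w} Ω → Sentence → Prop
  sat_of_iso : ∀ (A B : OmegaModel.{u, v, w} Ω), Nonempty (A ≃[Ω] B) →
    ∀ φ, Sat A φ → Sat B φ
  includes_firstOrder : ∃ ι : Ω.Sentence ↪ Sentence,
    ∀ (A : OmegaModel.{u, v, w} Ω) (φ : Ω.Sentence), Sat A (ι φ) ↔ A ⊨ φ
  closed_imp : ∀ φ ψ, ∃ χ, ∀ A : OmegaModel.{u, v, w} Ω, Sat A χ ↔ (Sat A φ → Sat A ψ)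

namespace ModelLanguage

variable {Ω : FirstOrder.Language.{u, v}}

/-- `L ⊆ K`: the sentences of `L` are among those of `K`, with the same satisfaction. -/
def Sub (L K : ModelLanguage.{u, v, w} Ω) : Prop :=
  ∃ ι : L.Sentence ↪ K.Sentence, ∀ A φ, K.Sat A (ι φ) ↔ L.Sat A φ

/-- The sentences of `K_◇`: they are built from sentences of `K` by Boolean connectives and `◇`. -/
abbrev DiaSentence (K : ModelLanguage.{u, v, w} Ω) : Type (max u v w) :=
  ModalFormula K.Sentence

/-- Satisfaction for `K_◇`, where `◇` is interpreted by the relation `R` on the class `C`. -/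
def DiaSat (K : ModelLanguage.{u, v, w} Ω) (C : Set (OmegaModel.{u, v, w} Ω))
    (R : OmegaModel.{u, v, w} Ω → OmegaModel.{u, v, w} Ω → Prop) :
    OmegaModel.{u, v, w} Ω → K.DiaSentence → Prop
  | A, .var s => K.Sat A s
  | _, .bot => False
  | A, .imp φ ψ => K.DiaSat C R A φ → K.DiaSat C R A ψ
  | A, .dia φ => ∃ B ∈ C, R A B ∧ K.DiaSat C R B φ

/-- The modal theory of `(C, R)` in `K`: the modal formulas that become true in all models of `C`
under every valuation of the propositional variables by sentences of `K_◇`; equivalently, the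
formulas with value `⊤` under every valuation in the Lindenbaum algebra of `K_◇` on `C`. -/
def MTh (K : ModelLanguage.{u, v, w} Ω) (C : Set (OmegaModel.{u, v, w} Ω))
    (R : OmegaModel.{u, v, w} Ω → OmegaModel.{u, v, w} Ω → Prop) : Set MF :=
  {φ | ∀ val : ℕ → K.DiaSentence, ∀ A ∈ C, K.DiaSat C R A (φ.subst val)}

/-- The modal theory of `(C, R)` in `L` is robust if it does not change when `L` is replaced by any
language `K ⊇ L`. -/
def IsRobust (L : ModelLanguage.{u, v, w} Ω) (C : Set (OmegaModel.{u, v, w} Ω))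
    (R : OmegaModel.{u, v, w} Ω → OmegaModel.{u, v, w} Ω → Prop) : Prop :=
  ∀ K : ModelLanguage.{u, v, w} Ω, L.Sub K → K.MTh C R = L.MTh C R

end ModelLanguage

/-- `Λ` is the robust theory of `(C, R)`: some language has a robust modal theory, and every
robust modal theory of `(C, R)` equals `Λ`. -/
def IsRobustTheory {Ω : FirstOrder.Language.{u, v}} (C : Set (OmegaModel.{u, v, w} Ω))
    (R : OmegaModel.{u, v, w} Ω → OmegaModel.{u, v, w} Ω → Prop) (Λ : Set MF) : Prop :=
  (∃ L : ModelLanguage.{u, v, w} Ω, L.IsRobust C R) ∧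
    ∀ L : ModelLanguage.{u, v, w} Ω, L.IsRobust C R → L.MTh C R = Λ

/-! ### Modal formulas: substitution and countability -/

namespace ModalFormula

/-! Soundness holds in every language: `QuotientRel` is reflexive and transitive, and every quotient
of A has, up to isomorphism, the same one-element quotient as A, which has no other quotients. So
□◇φ and ◇□φ both say that φ holds in the one-element quotient of A (`diaSat_box_dia_iff`).

Enlarging a language can only shrink its modal theory. It therefore suffices that every language
extends to one whose theory lies in S4.2.1 (`exists_sub_MTh_subset`): such an extension is robust,
and a robust theory coincides with that of its extension.

For completeness, a non-theorem is refuted at a point of the canonical model of S4.2.1, where every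
point w sees a point `top` that is seen by all points above w and sees only itself. A functional
symbol gives a unary operation x ↦ f(x,…,x). On a disjoint union of cycles of all prime lengths,
collapsing the cycle of the i-th prime is a "button": it can be pushed in a quotient independently
of the others and is never released. Countably many canonical points, each repeated at arbitrarily
large indices, label the buttons. A model is sent to the label of its last pushed button if the
labels increase, and to `top` otherwise. Quotients then respect accessibility, and each ◇ is
witnessed by pushing at most one more button (`diaSat_subst_iff`). Membership of a variable in the
assigned point is an isomorphism-invariant property, hence may be added as a sentence. -/

theorem subst_subst {V : Type*} {V' : Type*} {V'' : Type*} (σ : V → ModalFormula V')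
    (τ : V' → ModalFormula V'') (φ : ModalFormula V) :
    (φ.subst σ).subst τ = φ.subst fun i => (σ i).subst τ := by
  induction φ with
  | var _ => rfl
  | bot => rfl
  | imp _ _ ih₁ ih₂ => simp [subst, ih₁, ih₂]
  | dia _ ih => simp [subst, ih]

/-- An injective numbering of the propositional modal formulas. -/
def code : ModalFormula ℕ → ℕ
  | var n => Nat.pair 0 n
  | bot => Nat.pair 1 0
  | imp φ ψ => Nat.pair 2 (Nat.pair φ.code ψ.code)
  | dia φ => Nat.pair 3 φ.code

theorem code_injective : Function.Injective code := by
  intro φ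
  induction φ with
  | var n => intro ψ h; cases ψ <;> simp_all [code, Nat.pair_eq_pair]
  | bot => intro ψ h; cases ψ <;> simp_all [code, Nat.pair_eq_pair]
  | imp φ₁ φ₂ ih₁ ih₂ =>
    intro ψ h
    cases ψ with
    | imp ψ₁ ψ₂ =>
      simp only [code, Nat.pair_eq_pair, true_and] at h
      rw [ih₁ h.1, ih₂ h.2]
    | _ => simp [code, Nat.pair_eq_pair] at h
  | dia φ ih =>
    intro ψ h
    cases ψ with
    | dia ψ =>
      simp only [code, Nat.pair_eq_pair, true_and] at h
      rw [ih h]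
    | _ => simp [code, Nat.pair_eq_pair] at h

/-- Needed to enumerate finite lists of formulas in `exists_labelling`. -/
instance : Countable (ModalFormula ℕ) := code_injective.countable

end ModalFormula

open ModalFormula

/-! ### Normal logics and their canonical models -/

theorem isNormalLogic_smallestLogic (Γ : Set MF) : IsNormalLogic (smallestLogic Γ) where
  tautology φ h _ hΛ _ := hΛ.tautology φ h
  dia_bot _ hΛ _ := hΛ.dia_bot
  dia_or _ hΛ _ := hΛ.dia_or
  modus_ponens φ ψ h₁ h₂ Λ hΛ hΓ := hΛ.modus_ponens φ ψ (h₁ Λ hΛ hΓ) (h₂ Λ hΛ hΓ)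
  substitution φ σ h Λ hΛ hΓ := hΛ.substitution φ σ (h Λ hΛ hΓ)
  monotonicity φ ψ h Λ hΛ hΓ := hΛ.monotonicity φ ψ (h Λ hΛ hΓ)

theorem subset_smallestLogic (Γ : Set MF) : Γ ⊆ smallestLogic Γ :=
  fun _ h _ _ hΓ => hΓ h

/-- A set of formulas that includes a logic and is closed under modus ponens. -/
structure IsModalTheory (Λ T : Set MF) : Prop where
  logic_subset : Λ ⊆ T
  modus_ponens : ∀ φ ψ : MF, φ ∈ T → imp φ ψ ∈ T → ψ ∈ T

/-- The points of the canonical model of a logic: its maximal consistent theories. -/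
@[ext]
structure CanonicalWorld (Λ : Set MF) where
  carrier : Set MF
  bot_notMem : ModalFormula.bot ∉ carrier
  imp_mem : ∀ φ ψ, imp φ ψ ∈ carrier ↔ (φ ∈ carrier → ψ ∈ carrier)
  logic_subset : Λ ⊆ carrier

namespace IsModalTheory

variable {Λ T : Set MF}

theorem mem_of_tautology (hΛ : IsNormalLogic Λ) (hT : IsModalTheory Λ T) {φ : MF}
    (h : φ.IsTautology) : φ ∈ T :=
  hT.logic_subset (hΛ.tautology φ h)

/-- The theory generated by adding one formula. -/
theorem adjoin (hΛ : IsNormalLogic Λ) (hT : IsModalTheory Λ T) (χ : MF) :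
    IsModalTheory Λ {ψ | imp χ ψ ∈ T} where
  logic_subset φ hφ := hT.modus_ponens φ _ (hT.logic_subset hφ) <|
    hT.mem_of_tautology hΛ fun e _ hi => by simp only [hi]; tauto
  modus_ponens φ ψ h₁ h₂ := hT.modus_ponens _ _ h₂ <| hT.modus_ponens _ _ h₁ <|
    hT.mem_of_tautology hΛ fun e _ hi => by simp only [hi]; tauto

/-- Lindenbaum's lemma: Zorn gives a theory M maximal among those omitting φ, and maximality puts χ
→ φ into M for every χ outside M. -/
theorem exists_world (hΛ : IsNormalLogic Λ) (hT : IsModalTheory Λ T) {φ : MF} (hφ : φ ∉ T) :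
    ∃ w : CanonicalWorld Λ, T ⊆ w.carrier ∧ φ ∉ w.carrier := by
  obtain ⟨M, hTM, hM⟩ := zorn_subset_nonempty {U | IsModalTheory Λ U ∧ φ ∉ U} (by
    intro c hc hchain hne
    obtain ⟨U₀, hU₀⟩ := hne
    refine ⟨⋃₀ c, ⟨⟨?_, ?_⟩, ?_⟩, fun U hU => Set.subset_sUnion_of_mem hU⟩
    · exact (hc hU₀).1.logic_subset.trans (Set.subset_sUnion_of_mem hU₀)
    · rintro χ ψ ⟨U, hU, h₁⟩ ⟨U', hU', h₂⟩
      rcases hchain.total hU hU' with h | h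
      · exact ⟨U', hU', (hc hU').1.modus_ponens χ ψ (h h₁) h₂⟩
      · exact ⟨U, hU, (hc hU).1.modus_ponens χ ψ h₁ (h h₂)⟩
    · rintro ⟨U, hU, h⟩
      exact (hc hU).2 h) T ⟨hT, hφ⟩
  have hMt := hM.prop.1
  have hMφ := hM.prop.2
  have key : ∀ χ, χ ∉ M → imp χ φ ∈ M := by
    intro χ hχ
    by_contra h
    have hsub : M ⊆ {ψ | imp χ ψ ∈ M} := fun ψ hψ => hMt.modus_ponens _ _ hψ <|
      hMt.mem_of_tautology hΛ fun e _ hi => by simp only [hi]; tauto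
    have := hM.le_of_ge ⟨hMt.adjoin hΛ χ, h⟩ hsub
    exact hχ (this (hMt.mem_of_tautology hΛ fun e _ hi => by simp only [hi]; tauto))
  refine ⟨⟨M, fun h => hMφ ?_, fun χ ψ => ⟨fun h hχ => hMt.modus_ponens _ _ hχ h, fun h => ?_⟩,
    hMt.logic_subset⟩, hTM, hMφ⟩
  · exact hMt.modus_ponens _ _ h
      (hMt.mem_of_tautology hΛ fun e hb hi => by simp only [hi]; tauto)
  · by_cases hχ : χ ∈ M
    · exact hMt.modus_ponens _ _ (h hχ)
        (hMt.mem_of_tautology hΛ fun e _ hi => by simp only [hi]; tauto)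
    · by_contra hn
      -- If χ and χ → ψ both lie outside M, then both imply φ in M; one of them is always true, so φ
      -- would be in M.
      refine hMφ (hMt.modus_ponens _ _ (key _ hn) (hMt.modus_ponens _ _ (key _ hχ) ?_))
      exact hMt.mem_of_tautology hΛ fun e _ hi => by simp only [hi]; tauto

end IsModalTheory

namespace CanonicalWorld

variable {Λ : Set MF}

/-- The accessibility relation of the canonical model. -/
def Sees (w v : CanonicalWorld Λ) : Prop := ∀ χ ∈ v.carrier, dia χ ∈ w.carrier

theorem mp (w : CanonicalWorld Λ) {φ ψ : MF} (h : imp φ ψ ∈ Λ) (hφ : φ ∈ w.carrier) :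
    ψ ∈ w.carrier :=
  (w.imp_mem φ ψ).1 (w.logic_subset h) hφ

theorem neg_mem (w : CanonicalWorld Λ) (φ : MF) : neg φ ∈ w.carrier ↔ φ ∉ w.carrier := by
  rw [neg, w.imp_mem]
  exact ⟨fun h hφ => w.bot_notMem (h hφ), fun h hφ => absurd hφ h⟩

theorem or_mem (w : CanonicalWorld Λ) (φ ψ : MF) :
    or φ ψ ∈ w.carrier ↔ φ ∈ w.carrier ∨ ψ ∈ w.carrier := by
  rw [ModalFormula.or, w.imp_mem, w.neg_mem, or_iff_not_imp_left]

theorem iff_mem (w : CanonicalWorld Λ) (φ ψ : MF) :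
    iff φ ψ ∈ w.carrier ↔ (φ ∈ w.carrier ↔ ψ ∈ w.carrier) := by
  simp only [iff, ModalFormula.and, neg_mem, imp_mem]
  tauto

theorem eq_of_subset {w v : CanonicalWorld Λ} (h : w.carrier ⊆ v.carrier) : w = v := by
  refine CanonicalWorld.ext (h.antisymm fun φ hφ => ?_)
  by_contra hn
  exact (v.neg_mem φ).1 (h ((w.neg_mem φ).2 hn)) hφ

variable (hΛ : IsNormalLogic Λ)
include hΛ

theorem dia_or (w : CanonicalWorld Λ) {φ ψ : MF} (h : dia (or φ ψ) ∈ w.carrier) :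
    dia φ ∈ w.carrier ∨ dia ψ ∈ w.carrier := by
  rw [← or_mem]
  exact w.mp (hΛ.substitution _ (fun n => if n = 0 then φ else ψ) hΛ.dia_or) h

theorem dia_mono (w : CanonicalWorld Λ) {φ ψ : MF} (h : imp φ ψ ∈ Λ) (hφ : dia φ ∈ w.carrier) :
    dia ψ ∈ w.carrier :=
  w.mp (hΛ.monotonicity φ ψ h) hφ

theorem dia_bot_notMem (w : CanonicalWorld Λ) : dia ModalFormula.bot ∉ w.carrier :=
  (w.neg_mem _).1 (w.logic_subset hΛ.dia_bot)

/-- The formulas χ with □(ψ → χ) in w form a consistent theory; any world extending it contains ψ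
and is seen by w. -/
theorem exists_sees (w : CanonicalWorld Λ) {ψ : MF} (h : dia ψ ∈ w.carrier) :
    ∃ v, w.Sees v ∧ ψ ∈ v.carrier := by
  have hT : IsModalTheory Λ {χ | dia (neg (imp ψ χ)) ∉ w.carrier} := by
    refine ⟨fun χ hχ hn => w.dia_bot_notMem hΛ (w.dia_mono hΛ ?_ hn), fun χ χ' h₁ h₂ hn => ?_⟩
    · refine hΛ.modus_ponens _ _ hχ (hΛ.tautology _ fun e hb hi => ?_)
      simp only [neg, hi]; tauto
    · have := w.dia_or hΛ (φ := neg (imp ψ χ)) (ψ := neg (imp ψ (imp χ χ')))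
        (w.dia_mono hΛ (hΛ.tautology _ fun e hb hi => ?_) hn)
      · exact this.elim h₁ h₂
      · simp only [neg, ModalFormula.or, hi]; tauto
  obtain ⟨v, hTv, -⟩ := hT.exists_world hΛ (φ := .bot) (fun hn => hn <|
    w.dia_mono hΛ (hΛ.tautology _ fun e hb hi => by simp only [neg, hi]; tauto) h)
  refine ⟨v, fun χ hχ => ?_, hTv fun hn => ?_⟩
  · by_contra hn
    refine (v.neg_mem χ).1 ((v.imp_mem ψ (neg χ)).1 (hTv fun hd => hn ?_) ?_) hχ
    · exact w.dia_mono hΛ (hΛ.tautology _ fun e hb hi => by simp only [neg, hi]; tauto) hd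
    · exact hTv fun hd => w.dia_bot_notMem hΛ
        (w.dia_mono hΛ (hΛ.tautology _ fun e hb hi => by simp only [neg, hi]; tauto) hd)
  · exact w.dia_bot_notMem hΛ
      (w.dia_mono hΛ (hΛ.tautology _ fun e hb hi => by simp only [neg, hi]; tauto) hn)

theorem dia_mem (w : CanonicalWorld Λ) (ψ : MF) :
    dia ψ ∈ w.carrier ↔ ∃ v, w.Sees v ∧ ψ ∈ v.carrier :=
  ⟨w.exists_sees hΛ, fun ⟨_, hv, h⟩ => hv _ h⟩

theorem box_mem (w : CanonicalWorld Λ) (ψ : MF) :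
    box ψ ∈ w.carrier ↔ ∀ v, w.Sees v → ψ ∈ v.carrier := by
  rw [box, neg_mem, dia_mem hΛ]
  simp only [neg_mem]
  push Not
  rfl

end CanonicalWorld

/-! ### The canonical model of S4.2.1 -/

theorem isNormalLogic_logicS421 : IsNormalLogic logicS421 := isNormalLogic_smallestLogic _

/-- The points of the canonical model of `S4.2.1`. -/
abbrev WorldS421 : Type := CanonicalWorld logicS421

namespace WorldS421

open CanonicalWorld

theorem dia_mem_iff (w : WorldS421) (ψ : MF) :
    dia ψ ∈ w.carrier ↔ ∃ v : WorldS421, w.Sees v ∧ ψ ∈ v.carrier :=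
  dia_mem isNormalLogic_logicS421 w ψ

theorem box_mem_iff (w : WorldS421) (ψ : MF) :
    box ψ ∈ w.carrier ↔ ∀ v : WorldS421, w.Sees v → ψ ∈ v.carrier :=
  box_mem isNormalLogic_logicS421 w ψ

theorem mem_of_axiomS4 {φ : MF}
    (h : φ ∈ ({imp (dia (dia MF.p)) (dia MF.p), imp MF.p (dia MF.p)} : Set MF)) :
    φ ∈ logicS421 :=
  subset_smallestLogic _ (Or.inl (subset_smallestLogic _ h))

theorem sees_refl (w : WorldS421) : w.Sees w := fun χ hχ =>
  w.mp (isNormalLogic_logicS421.substitution _ (fun _ => χ)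
    (mem_of_axiomS4 (Or.inr rfl))) hχ

theorem sees_trans {w v u : WorldS421} (h₁ : w.Sees v) (h₂ : v.Sees u) : w.Sees u := fun χ hχ =>
  w.mp (isNormalLogic_logicS421.substitution _ (fun _ => χ)
    (mem_of_axiomS4 (Or.inl rfl))) (h₁ _ (h₂ χ hχ))

theorem box_dia_mem_iff (w : WorldS421) (χ : MF) :
    box (dia χ) ∈ w.carrier ↔ dia (box χ) ∈ w.carrier :=
  (w.iff_mem _ _).1 (w.logic_subset (isNormalLogic_logicS421.substitution _ (fun _ => χ)
    (subset_smallestLogic _ (Or.inr rfl))))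

/-- The greatest point seen by a point: the limit of its truths. -/
def top (w : WorldS421) : WorldS421 where
  carrier := {χ | dia (box χ) ∈ w.carrier}
  bot_notMem h := by
    obtain ⟨v, -, hv⟩ := (w.dia_mem_iff _).1 h
    exact v.bot_notMem ((v.box_mem_iff _).1 hv v v.sees_refl)
  imp_mem χ ψ := by
    constructor
    · intro h₁ h₂
      obtain ⟨v, hwv, hv⟩ := (w.dia_mem_iff _).1 h₂
      -- The points witnessing ◇□χ and ◇□(χ → ψ) may differ. Turning the latter into □◇□(χ → ψ)
      -- yields a witness above v, where χ persists.
      have hbox : box (dia (box (imp χ ψ))) ∈ w.carrier := by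
        rw [box_dia_mem_iff]
        obtain ⟨u, hwu, hu⟩ := (w.dia_mem_iff _).1 h₁
        exact (w.dia_mem_iff _).2 ⟨u, hwu, (u.box_mem_iff _).2 fun x hux =>
          (x.box_mem_iff _).2 fun y hxy => (u.box_mem_iff _).1 hu y (sees_trans hux hxy)⟩
      obtain ⟨u, hvu, hu⟩ := (v.dia_mem_iff _).1 ((w.box_mem_iff _).1 hbox v hwv)
      exact (w.dia_mem_iff _).2 ⟨u, sees_trans hwv hvu, (u.box_mem_iff _).2 fun x hux =>
        (x.imp_mem _ _).1 ((u.box_mem_iff _).1 hu x hux)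
          ((v.box_mem_iff _).1 hv x (sees_trans hvu hux))⟩
    · intro h
      by_cases hχ : dia (box χ) ∈ w.carrier
      · obtain ⟨u, hwu, hu⟩ := (w.dia_mem_iff _).1 (h hχ)
        exact (w.dia_mem_iff _).2 ⟨u, hwu, (u.box_mem_iff _).2 fun x hux =>
          (x.imp_mem _ _).2 fun _ => (u.box_mem_iff _).1 hu x hux⟩
      -- If ◇□χ fails, so does □◇χ: some point above w has no χ above it, and χ → ψ holds vacuously
      -- from there on.
      · rw [← box_dia_mem_iff, box_mem_iff] at hχ
        push Not at hχ
        obtain ⟨u, hwu, hu⟩ := hχ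
        exact (w.dia_mem_iff _).2 ⟨u, hwu, (u.box_mem_iff _).2 fun x hux =>
          (x.imp_mem _ _).2 fun hx => absurd (hux _ hx) hu⟩
  logic_subset φ hφ := (w.dia_mem_iff _).2
    ⟨w, w.sees_refl, (w.box_mem_iff _).2 fun v _ => v.logic_subset hφ⟩

theorem sees_top {w v : WorldS421} (h : w.Sees v) : v.Sees w.top := fun χ hχ =>
  (w.box_mem_iff _).1 ((w.box_dia_mem_iff χ).2 hχ) v h

/-- If χ holds at v, then ◇χ holds at `top`, that is, ◇□◇χ holds at w. The axiom turns the inner □◇χ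
into ◇□χ, so χ is in `top`. -/
theorem eq_top_of_sees {w v : WorldS421} (h : w.top.Sees v) : v = w.top := by
  refine eq_of_subset fun χ hχ => ?_
  obtain ⟨u, hwu, hu⟩ := (w.dia_mem_iff _).1 (show dia (box (dia χ)) ∈ w.carrier from h χ hχ)
  obtain ⟨x, hux, hx⟩ := (u.dia_mem_iff _).1 ((u.box_dia_mem_iff χ).1 hu)
  exact (w.dia_mem_iff _).2 ⟨x, sees_trans hwu hux, hx⟩

/-- The points above `w` contain a countable set with witnesses for `◇`, enumerated so that every
member occurs infinitely often. -/
theorem exists_labelling (w : WorldS421) : ∃ lab : ℕ → WorldS421, lab 0 = w ∧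
    (∀ i, w.Sees (lab i)) ∧
    ∀ (i : ℕ) (ψ : MF) (m : ℕ), dia ψ ∈ (lab i).carrier →
      ∃ j, m < j ∧ (lab i).Sees (lab j) ∧ ψ ∈ (lab j).carrier := by
  have hstep : ∀ (ψ : MF) (v : WorldS421), ∃ u : WorldS421,
      v.Sees u ∧ (dia ψ ∈ v.carrier → ψ ∈ u.carrier) := by
    intro ψ v
    by_cases h : dia ψ ∈ v.carrier
    · obtain ⟨u, hu, h'⟩ := (v.dia_mem_iff ψ).1 h
      exact ⟨u, hu, fun _ => h'⟩
    · exact ⟨v, v.sees_refl, fun h' => absurd h' h⟩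
  choose step hsees hmem using hstep
  have habove : ∀ l : List MF, w.Sees (l.foldr step w) := by
    intro l
    induction l with
    | nil => exact w.sees_refl
    | cons ψ l ih => exact sees_trans ih (hsees ψ _)
  obtain ⟨enum, henum⟩ := exists_surjective_nat (List MF)
  -- An index codes a list of witness requests in its first component; the second only forces
  -- repetitions. Index 0 is reserved for the empty list, so that its label is w.
  let path : ℕ → List MF := fun i => if i = 0 then [] else enum (Nat.unpair i).1
  refine ⟨fun i => (path i).foldr step w, rfl, fun i => habove _, fun i ψ m h => ?_⟩
  obtain ⟨k, hk⟩ := henum (ψ :: path i)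
  have hlt : m < Nat.pair k (m + 1) := Nat.right_le_pair k (m + 1)
  have hpath : path (Nat.pair k (m + 1)) = ψ :: path i := by
    simp only [path, Nat.unpair_pair, hk]
    rw [if_neg (by omega)]
  refine ⟨Nat.pair k (m + 1), hlt, ?_⟩
  simp only [hpath]
  exact ⟨hsees ψ _, hmem ψ _ h⟩

end WorldS421

theorem exists_world_of_notMem_logicS421 {φ : MF} (h : φ ∉ logicS421) :
    ∃ w : WorldS421, φ ∉ w.carrier := by
  obtain ⟨w, -, hw⟩ := IsModalTheory.exists_world isNormalLogic_logicS421
    (T := logicS421) ⟨subset_rfl, isNormalLogic_logicS421.modus_ponens⟩ h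
  exact ⟨w, hw⟩

/-! ### Quotient maps of models -/

section Quotients

variable {Ω : FirstOrder.Language.{u, v}}

open FirstOrder.Language.Structure Function

/-- Maps of structures that induce an isomorphism from a quotient of the domain. -/
structure IsQuotientMap {A B : Type*} [Ω.Structure A] [Ω.Structure B] (π : A → B) : Prop where
  surjective : Function.Surjective π
  map_fun : ∀ {n : ℕ} (f : Ω.Functions n) (x : Fin n → A), π (funMap f x) = funMap f (π ∘ x)
  map_rel : ∀ {n : ℕ} (P : Ω.Relations n) (y : Fin n → B),
    RelMap P y ↔ ∃ x : Fin n → A, π ∘ x = y ∧ RelMap P x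

namespace IsQuotientMap

theorem comp {A B C : Type*} [Ω.Structure A] [Ω.Structure B] [Ω.Structure C] {ρ : B → C}
    {π : A → B} (hρ : IsQuotientMap (Ω := Ω) ρ) (hπ : IsQuotientMap (Ω := Ω) π) :
    IsQuotientMap (Ω := Ω) (ρ ∘ π) where
  surjective := hρ.surjective.comp hπ.surjective
  map_fun f x := by simp only [comp_apply, hπ.map_fun, hρ.map_fun]; rfl
  map_rel P z := by
    rw [hρ.map_rel]
    constructor
    · rintro ⟨y, rfl, hy⟩
      obtain ⟨x, rfl, hx⟩ := (hπ.map_rel P y).1 hy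
      exact ⟨x, rfl, hx⟩
    · rintro ⟨x, rfl, hx⟩
      exact ⟨π ∘ x, rfl, (hπ.map_rel P _).2 ⟨x, rfl, hx⟩⟩

theorem of_equiv {A B : Type*} [Ω.Structure A] [Ω.Structure B] (e : A ≃[Ω] B) :
    IsQuotientMap (Ω := Ω) e where
  surjective := e.surjective
  map_fun f x := e.map_fun f x
  map_rel P y := by
    constructor
    · intro h
      have hy : e ∘ (e.symm ∘ y) = y := by ext i; simp
      exact ⟨e.symm ∘ y, hy, by rwa [← e.map_rel, hy]⟩
    · rintro ⟨x, rfl, hx⟩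
      exact (e.map_rel P x).2 hx

theorem cls {A : Type*} [Ω.Structure A] (θ : ModelCongruence Ω A) :
    IsQuotientMap (Ω := Ω) θ.cls where
  surjective := θ.cls_surjective
  map_fun f x := (θ.funMap_cls f x).symm
  map_rel P y := by
    refine exists_congr fun a => and_congr_left fun _ => ?_
    exact funext_iff.symm

/-- The congruence of a quotient map. -/
def ker {A B : Type w} [Ω.Structure A] [Ω.Structure B] {π : A → B}
    (hπ : IsQuotientMap (Ω := Ω) π) : ModelCongruence Ω A where
  toSetoid := Setoid.ker π
  funMap_rel f x y h := by
    change π _ = π _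
    rw [hπ.map_fun, hπ.map_fun]
    exact congrArg _ (funext h)

theorem nonempty_equiv {A B : Type w} [Ω.Structure A] [Ω.Structure B] {π : A → B}
    (hπ : IsQuotientMap (Ω := Ω) π) : Nonempty (hπ.ker.Quot ≃[Ω] B) := by
  let e : hπ.ker.Quot ≃ B := Setoid.quotientKerEquivOfSurjective π hπ.surjective
  have he : ∀ a, e (hπ.ker.cls a) = π a := fun _ => rfl
  have hlift : ∀ {n : ℕ} (y : Fin n → hπ.ker.Quot), ∃ x : Fin n → A, hπ.ker.cls ∘ x = y :=
    fun y => ⟨_, funext fun i => surjInv_eq hπ.ker.cls_surjective (y i)⟩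
  refine ⟨⟨e, fun f y => ?_, fun P y => ?_⟩⟩
  · obtain ⟨x, rfl⟩ := hlift y
    rw [← (IsQuotientMap.cls hπ.ker).map_fun]
    exact hπ.map_fun f x
  · change RelMap P (e ∘ y) ↔ _
    rw [hπ.map_rel, (IsQuotientMap.cls hπ.ker).map_rel]
    refine exists_congr fun x => and_congr_left fun _ => ?_
    constructor
    · intro h
      exact funext fun i => e.injective (congrFun h i)
    · rintro rfl
      rfl

end IsQuotientMap

theorem quotientRel_iff {A B : OmegaModel.{u, v, w} Ω} :
    QuotientRel A B ↔ ∃ π : A → B, IsQuotientMap (Ω := Ω) π := by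
  constructor
  · rintro ⟨θ, ⟨e⟩⟩
    exact ⟨_, (IsQuotientMap.of_equiv e).comp (IsQuotientMap.cls θ)⟩
  · rintro ⟨π, hπ⟩
    exact ⟨hπ.ker, hπ.nonempty_equiv⟩

theorem QuotientRel.trans {A B C : OmegaModel.{u, v, w} Ω} (h₁ : QuotientRel A B)
    (h₂ : QuotientRel B C) : QuotientRel A C := by
  rw [quotientRel_iff] at *
  obtain ⟨π, hπ⟩ := h₁
  obtain ⟨ρ, hρ⟩ := h₂
  exact ⟨_, hρ.comp hπ⟩

theorem QuotientRel.of_iso {A B : OmegaModel.{u, v, w} Ω} (h : Nonempty (A ≃[Ω] B)) :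
    QuotientRel A B :=
  quotientRel_iff.2 ⟨_, IsQuotientMap.of_equiv h.some⟩

theorem QuotientRel.refl (A : OmegaModel.{u, v, w} Ω) : QuotientRel A A :=
  QuotientRel.of_iso ⟨.refl Ω A⟩

/-- The quotient of a model as a model. -/
noncomputable def quotientModel (A : OmegaModel.{u, v, w} Ω) (θ : ModelCongruence Ω A) :
    OmegaModel.{u, v, w} Ω where
  Carrier := θ.Quot
  struc := θ.quotStructure
  nonempty' := ⟨θ.cls (Classical.arbitrary A)⟩

theorem quotientRel_quotientModel (A : OmegaModel.{u, v, w} Ω) (θ : ModelCongruence Ω A) :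
    QuotientRel A (quotientModel A θ) :=
  ⟨θ, ⟨.refl Ω θ.Quot⟩⟩

/-- The greatest congruence. -/
def totalCongruence (A : Type w) [Ω.Structure A] : ModelCongruence Ω A where
  toSetoid := ⊤
  funMap_rel _ _ _ _ := trivial

/-- The one-element quotient of a model. -/
noncomputable def terminalQuotient (A : OmegaModel.{u, v, w} Ω) : OmegaModel.{u, v, w} Ω :=
  quotientModel A (totalCongruence A)

instance (A : OmegaModel.{u, v, w} Ω) : Subsingleton (terminalQuotient A) :=
  ⟨fun x y => by
    obtain ⟨a, rfl⟩ := (totalCongruence (Ω := Ω) A).cls_surjective x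
    obtain ⟨b, rfl⟩ := (totalCongruence (Ω := Ω) A).cls_surjective y
    exact ((totalCongruence (Ω := Ω) A).cls_eq_cls a b).2 trivial⟩

theorem QuotientRel.terminalQuotient (A : OmegaModel.{u, v, w} Ω) :
    QuotientRel A (terminalQuotient A) :=
  quotientRel_quotientModel A _

/-- One-element quotients of a model are determined up to isomorphism. -/
theorem nonempty_equiv_of_subsingleton {A B C : OmegaModel.{u, v, w} Ω} [Subsingleton B]
    [Subsingleton C] (h₁ : QuotientRel A B) (h₂ : QuotientRel A C) : Nonempty (B ≃[Ω] C) := by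
  obtain ⟨π, hπ⟩ := quotientRel_iff.1 h₁
  obtain ⟨ρ, hρ⟩ := quotientRel_iff.1 h₂
  refine ⟨⟨⟨fun _ => Classical.arbitrary C, fun _ => Classical.arbitrary B,
    fun _ => Subsingleton.elim _ _, fun _ => Subsingleton.elim _ _⟩,
    fun _ _ => Subsingleton.elim _ _, fun P x => ?_⟩⟩
  -- In a one-element quotient of A a predicate holds iff it holds of some tuple of A.
  rw [hπ.map_rel, hρ.map_rel]
  exact exists_congr fun _ => and_congr_left fun _ =>
    ⟨fun _ => Subsingleton.elim _ _, fun _ => Subsingleton.elim _ _⟩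

theorem QuotientRel.subsingleton {A B : OmegaModel.{u, v, w} Ω} [Subsingleton A]
    (h : QuotientRel A B) : Subsingleton B := by
  obtain ⟨π, hπ⟩ := quotientRel_iff.1 h
  exact hπ.surjective.subsingleton

end Quotients

/-! ### Soundness of S4.2.1 -/

namespace ModelLanguage

variable {Ω : FirstOrder.Language.{u, v}}

section

variable (K : ModelLanguage.{u, v, w} Ω) {C : Set (OmegaModel.{u, v, w} Ω)}
  {R : OmegaModel.{u, v, w} Ω → OmegaModel.{u, v, w} Ω → Prop}

theorem isNormalLogic_MTh : IsNormalLogic (K.MTh C R) where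
  tautology φ h val A _ := h (fun χ => K.DiaSat C R A (χ.subst val)) id fun _ _ => Iff.rfl
  dia_bot val A _ := fun ⟨_, _, _, h⟩ => h
  dia_or val A _ := by
    rintro ⟨B, hB, hAB, h⟩ hn
    exact ⟨B, hB, hAB, h fun hp => hn ⟨B, hB, hAB, hp⟩⟩
  modus_ponens φ ψ h₁ h₂ val A hA := h₂ val A hA (h₁ val A hA)
  substitution φ σ h val A hA := by
    rw [subst_subst]
    exact h _ A hA
  monotonicity φ ψ h val A _ := fun ⟨B, hB, hAB, hφ⟩ => ⟨B, hB, hAB, h val B hB hφ⟩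

theorem diaSat_box (A : OmegaModel.{u, v, w} Ω) (φ : K.DiaSentence) :
    K.DiaSat C R A (box φ) ↔ ∀ B ∈ C, R A B → K.DiaSat C R B φ := by
  change (¬ ∃ B ∈ C, R A B ∧ ¬ K.DiaSat C R B φ) ↔ _
  push Not
  rfl

theorem diaSat_iff (A : OmegaModel.{u, v, w} Ω) (φ ψ : K.DiaSentence) :
    K.DiaSat C R A (ModalFormula.iff φ ψ) ↔ (K.DiaSat C R A φ ↔ K.DiaSat C R A ψ) := by
  change (((K.DiaSat C R A φ → K.DiaSat C R A ψ) →
    (K.DiaSat C R A ψ → K.DiaSat C R A φ) → False) → False) ↔ _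
  tauto

end

variable (K : ModelLanguage.{u, v, w} Ω)

theorem diaSat_of_iso {A B : OmegaModel.{u, v, w} Ω} (e : Nonempty (A ≃[Ω] B))
    (φ : K.DiaSentence) (h : K.DiaSat Set.univ QuotientRel A φ) :
    K.DiaSat Set.univ QuotientRel B φ := by
  induction φ generalizing A B with
  | var s => exact K.sat_of_iso A B e s h
  | bot => exact h
  | imp φ ψ ih₁ ih₂ => exact fun hφ => ih₂ e (h (ih₁ ⟨e.some.symm⟩ hφ))
  | dia φ _ =>
    obtain ⟨C, hC, hAC, hφ⟩ := h
    exact ⟨C, hC, (QuotientRel.of_iso ⟨e.some.symm⟩).trans hAC, hφ⟩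

/-- Each side is equivalent to φ in the one-element quotient of A, since a quotient of the
one-element quotient of any B ≤ A is isomorphic to it. -/
theorem diaSat_box_dia_iff (A : OmegaModel.{u, v, w} Ω) (φ : K.DiaSentence) :
    K.DiaSat Set.univ QuotientRel A (box (dia φ)) ↔
      K.DiaSat Set.univ QuotientRel A (dia (box φ)) := by
  have key : ∀ B C, QuotientRel A B → QuotientRel (terminalQuotient B) C →
      Nonempty (C ≃[Ω] terminalQuotient A) := by
    intro B C hAB hBC
    have := hBC.subsingleton
    exact nonempty_equiv_of_subsingleton (hAB.trans ((QuotientRel.terminalQuotient B).trans hBC))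
      (QuotientRel.terminalQuotient A)
  rw [diaSat_box]
  constructor
  · intro h
    obtain ⟨B, -, hB, hφ⟩ := h _ trivial (QuotientRel.terminalQuotient A)
    refine ⟨_, trivial, QuotientRel.terminalQuotient A, (K.diaSat_box _ _).2 fun C _ hC => ?_⟩
    have e := (key A C (.refl A) hC).some
    exact K.diaSat_of_iso ⟨e.symm⟩ φ (K.diaSat_of_iso (key A B (.refl A) hB) φ hφ)
  · rintro ⟨B, -, hAB, hB⟩ C - hAC
    have h := (K.diaSat_box _ _).1 hB _ trivial (QuotientRel.terminalQuotient B)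
    have e₁ := key B _ hAB (.refl _)
    have e₂ := (key C _ hAC (.refl _)).some
    exact ⟨_, trivial, QuotientRel.terminalQuotient C,
      K.diaSat_of_iso ⟨e₂.symm⟩ φ (K.diaSat_of_iso e₁ φ h)⟩

theorem logicS421_subset_MTh : logicS421 ⊆ K.MTh Set.univ QuotientRel := by
  refine fun φ h => h _ K.isNormalLogic_MTh (Set.union_subset ?_ ?_)
  · refine fun φ h => h _ K.isNormalLogic_MTh ?_
    rintro _ (rfl | rfl)
    · rintro val A - ⟨B, -, hAB, C, hC, hBC, h⟩
      exact ⟨C, hC, hAB.trans hBC, h⟩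
    · exact fun val A hA h => ⟨A, hA, .refl A, h⟩
  · rintro _ rfl val A -
    exact (K.diaSat_iff A _ _).2 (K.diaSat_box_dia_iff A (val 0))

/-! ### Extending a language by new sentences -/

theorem MTh_subset_of_sub {L K : ModelLanguage.{u, v, w} Ω} (h : L.Sub K)
    (C : Set (OmegaModel.{u, v, w} Ω))
    (R : OmegaModel.{u, v, w} Ω → OmegaModel.{u, v, w} Ω → Prop) : K.MTh C R ⊆ L.MTh C R := by
  obtain ⟨ι, hι⟩ := h
  have key : ∀ (φ : L.DiaSentence) A,
      K.DiaSat C R A (φ.subst fun s => .var (ι s)) ↔ L.DiaSat C R A φ := by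
    intro φ
    induction φ with
    | var s => exact fun A => hι A s
    | bot => exact fun A => Iff.rfl
    | imp φ ψ ih₁ ih₂ => exact fun A => imp_congr (ih₁ A) (ih₂ A)
    | dia φ ih => exact fun A => exists_congr fun B => and_congr_right fun _ =>
        and_congr_right fun _ => ih B
  intro φ hφ val A hA
  rw [← key, subst_subst]
  exact hφ _ A hA

/-- Implicational combinations of atoms. -/
inductive ImpComb (α : Type*)
  | atom : α → ImpComb α
  | imp : ImpComb α → ImpComb α → ImpComb α

/-- The truth value of a combination. -/
def ImpComb.eval {α : Type*} (e : α → Prop) : ImpComb α → Prop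
  | .atom a => e a
  | .imp φ ψ => φ.eval e → ψ.eval e

theorem ImpComb.eval_congr {α : Type*} {e e' : α → Prop} (h : ∀ a, e a ↔ e' a) (φ : ImpComb α) :
    φ.eval e ↔ φ.eval e' := by
  rw [funext fun a => propext (h a)]

/-- The language obtained from `L` by adding sentences for given isomorphism-invariant properties
of models. -/
def extend (L : ModelLanguage.{u, v, w} Ω) {I : Type} (P : I → OmegaModel.{u, v, w} Ω → Prop)
    (hP : ∀ i (A B : OmegaModel.{u, v, w} Ω), Nonempty (A ≃[Ω] B) → P i A → P i B) :
    ModelLanguage.{u, v, w} Ω where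
  Sentence := ImpComb (L.Sentence ⊕ I)
  Sat A φ := φ.eval (Sum.elim (L.Sat A) fun i => P i A)
  sat_of_iso A B e φ := by
    have e' : Nonempty (B ≃[Ω] A) := ⟨e.some.symm⟩
    refine (ImpComb.eval_congr ?_ φ).1
    rintro (s | i)
    · exact ⟨L.sat_of_iso A B e s, L.sat_of_iso B A e' s⟩
    · exact ⟨hP i A B e, hP i B A e'⟩
  includes_firstOrder := by
    obtain ⟨ι, hι⟩ := L.includes_firstOrder
    exact ⟨⟨fun s => .atom (.inl (ι s)), fun s t h => ι.injective (by injections)⟩, hι⟩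
  closed_imp φ ψ := ⟨.imp φ ψ, fun _ => Iff.rfl⟩

theorem sub_extend (L : ModelLanguage.{u, v, w} Ω) {I : Type}
    (P : I → OmegaModel.{u, v, w} Ω → Prop)
    (hP : ∀ i (A B : OmegaModel.{u, v, w} Ω), Nonempty (A ≃[Ω] B) → P i A → P i B) :
    L.Sub (L.extend P hP) :=
  ⟨⟨fun s => .atom (.inl s), fun s t h => by injections⟩, fun _ _ => Iff.rfl⟩

/-- Finitary first-order logic. -/
def firstOrder (Ω : FirstOrder.Language.{u, v}) : ModelLanguage.{u, v, w} Ω where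
  Sentence := ULift.{w} Ω.Sentence
  Sat A φ := A ⊨ φ.down
  sat_of_iso _ _ e φ h := (FirstOrder.Language.StrongHomClass.realize_sentence e.some φ.down).1 h
  includes_firstOrder := ⟨Equiv.ulift.symm.toEmbedding, fun _ _ => Iff.rfl⟩
  closed_imp φ ψ := ⟨⟨φ.down.imp ψ.down⟩, fun _ => FirstOrder.Language.Formula.realize_imp⟩

end ModelLanguage

/-! ### Models with independent buttons -/

section Buttons

variable {Ω : FirstOrder.Language.{u, v}} {n : ℕ} (f : Ω.Functions (n + 1))

open FirstOrder.Language.Structure Function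

/-- The unary operation obtained by identifying all arguments of `f`. -/
def diagonal {A : Type*} [Ω.Structure A] (x : A) : A := funMap f fun _ => x

/-- The pushed buttons: the indices `i` for which no proper cycle of the diagonal of `f` has
the `i`-th prime as its length. -/
def pushedButtons (A : Type*) [Ω.Structure A] : Set ℕ :=
  {i | ∀ x : A, IsPeriodicPt (diagonal f) (Nat.nth Nat.Prime i) x → IsFixedPt (diagonal f) x}

/-- All operations that are not constants depend only on the first argument and agree with the
diagonal of `f`, which is a union of cycles of prime lengths and fixed points. -/
structure IsPrimeCyclic (A : Type*) [Ω.Structure A] : Prop where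
  funMap_eq : ∀ {k : ℕ} (h : Ω.Functions (k + 1)) (x : Fin (k + 1) → A),
    funMap h x = diagonal f (x 0)
  exists_isPeriodicPt : ∀ x : A, ∃ i, IsPeriodicPt (diagonal f) (Nat.nth Nat.Prime i) x

/-- Two coprime periods force period 1; this keeps distinct buttons independent. -/
theorem isFixedPt_of_isPeriodicPt_nth_prime {α : Type*} {g : α → α} {x : α} {i j : ℕ}
    (hij : i ≠ j) (hi : IsPeriodicPt g (Nat.nth Nat.Prime i) x)
    (hj : IsPeriodicPt g (Nat.nth Nat.Prime j) x) : IsFixedPt g x := by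
  have hne : Nat.nth Nat.Prime i ≠ Nat.nth Nat.Prime j := fun h =>
    hij (Nat.nth_injective Nat.infinite_setOfPred_prime h)
  have h := hi.gcd hj
  rw [(Nat.coprime_primes (Nat.prime_nth_prime i) (Nat.prime_nth_prime j)).2 hne] at h
  exact h

variable {f}

namespace IsQuotientMap

variable {A B : Type*} [Ω.Structure A] [Ω.Structure B] {π : A → B}
  (hπ : IsQuotientMap (Ω := Ω) π)
include hπ

theorem semiconj : Semiconj π (diagonal f) (diagonal f) := fun _ => hπ.map_fun f _

theorem isPrimeCyclic (hA : IsPrimeCyclic f A) : IsPrimeCyclic f B where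
  funMap_eq h y := by
    obtain ⟨x, rfl⟩ := hπ.surjective.comp_left y
    rw [← hπ.map_fun, hA.funMap_eq, hπ.semiconj.eq]
    rfl
  exists_isPeriodicPt y := by
    obtain ⟨x, rfl⟩ := hπ.surjective y
    obtain ⟨i, hi⟩ := hA.exists_isPeriodicPt x
    exact ⟨i, hi.map hπ.semiconj⟩

/-- A preimage of y has some prime period. If it is the i-th prime, the preimage is already fixed;
otherwise y has two coprime periods. -/
theorem pushedButtons_subset (hA : IsPrimeCyclic f A) : pushedButtons f A ⊆ pushedButtons f B := by
  intro i hi y hy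
  obtain ⟨x, rfl⟩ := hπ.surjective y
  obtain ⟨j, hj⟩ := hA.exists_isPeriodicPt x
  by_cases hij : i = j
  · subst hij
    exact (hi x hj).map hπ.semiconj
  · exact isFixedPt_of_isPeriodicPt_nth_prime hij hy (hj.map hπ.semiconj)

end IsQuotientMap

theorem pushedButtons_subset_of_equiv {A B : Type*} [Ω.Structure A] [Ω.Structure B]
    (e : A ≃[Ω] B) : pushedButtons f A ⊆ pushedButtons f B := by
  intro i hi y hy
  have h := (hi _ (hy.map (IsQuotientMap.of_equiv e.symm).semiconj)).map
    (IsQuotientMap.of_equiv e).semiconj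
  simpa using h

theorem pushedButtons_eq_of_equiv {A B : Type*} [Ω.Structure A] [Ω.Structure B] (e : A ≃[Ω] B) :
    pushedButtons f A = pushedButtons f B :=
  (pushedButtons_subset_of_equiv e).antisymm (pushedButtons_subset_of_equiv e.symm)

/-- Pushing a button: the points of period the `i`-th prime are identified. -/
def buttonCongruence {A : Type*} [Ω.Structure A] (hA : IsPrimeCyclic f A) (i : ℕ) :
    ModelCongruence Ω A where
  r x y := x = y ∨ IsPeriodicPt (diagonal f) (Nat.nth Nat.Prime i) x ∧
    IsPeriodicPt (diagonal f) (Nat.nth Nat.Prime i) y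
  iseqv :=
    { refl := fun _ => Or.inl rfl
      symm := by
        rintro x y (rfl | ⟨hx, hy⟩)
        exacts [Or.inl rfl, Or.inr ⟨hy, hx⟩]
      trans := by
        rintro x y z (rfl | ⟨hx, hy⟩) (rfl | ⟨hy', hz⟩)
        exacts [Or.inl rfl, Or.inr ⟨hy', hz⟩, Or.inr ⟨hx, hy⟩, Or.inr ⟨hx, hz⟩] }
  funMap_rel {k} h x y hxy := by
    cases k with
    | zero => exact Or.inl (congrArg _ (Subsingleton.elim _ _))
    | succ k =>
      rw [hA.funMap_eq, hA.funMap_eq]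
      rcases hxy 0 with h | ⟨hx, hy⟩
      · exact Or.inl (congrArg _ h)
      · exact Or.inr ⟨hx.apply, hy.apply⟩

/-- Only points of period the i-th prime are merged. Fixed points are among them, which is harmless:
a point that also has another prime period was fixed already. -/
theorem pushedButtons_buttonCongruence {A : Type*} [Ω.Structure A] (hA : IsPrimeCyclic f A)
    (i : ℕ) : pushedButtons f (buttonCongruence hA i).Quot = insert i (pushedButtons f A) := by
  have hπ := IsQuotientMap.cls (buttonCongruence hA i)
  have heq : ∀ {x y : A}, (buttonCongruence hA i).cls x = (buttonCongruence hA i).cls y ↔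
      x = y ∨ IsPeriodicPt (diagonal f) (Nat.nth Nat.Prime i) x ∧
        IsPeriodicPt (diagonal f) (Nat.nth Nat.Prime i) y :=
    fun {x y} => (buttonCongruence hA i).cls_eq_cls x y
  refine Set.Subset.antisymm (fun j hj => ?_) (Set.insert_subset ?_ (hπ.pushedButtons_subset hA))
  · refine or_iff_not_imp_left.2 fun hji x hx => ?_
    have h := hj _ (hx.map hπ.semiconj)
    rw [IsFixedPt, ← hπ.semiconj.eq, heq] at h
    rcases h with h | ⟨-, h⟩
    · exact h
    · exact isFixedPt_of_isPeriodicPt_nth_prime hji hx h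
  · intro y hy
    obtain ⟨x, rfl⟩ := hπ.surjective y
    -- If x is congruent to its iterate, they are equal or both already have the required period;
    -- either way x does, and so is congruent to its successor.
    rw [IsPeriodicPt, IsFixedPt, ← (hπ.semiconj.iterate_right _).eq, heq] at hy
    have hx : IsPeriodicPt (diagonal f) (Nat.nth Nat.Prime i) x := hy.elim id And.right
    rw [IsFixedPt, ← hπ.semiconj.eq, heq]
    exact Or.inr ⟨hx.apply, hx⟩

theorem exists_push_button {A : OmegaModel.{u, v, w} Ω} (hA : IsPrimeCyclic f A) (i : ℕ) :
    ∃ B : OmegaModel.{u, v, w} Ω, QuotientRel A B ∧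
      pushedButtons f B = insert i (pushedButtons f A) :=
  ⟨_, quotientRel_quotientModel A (buttonCongruence hA i), pushedButtons_buttonCongruence hA i⟩

/-- The disjoint union of cycles of all prime lengths. -/
abbrev PrimeCycles : Type w := ULift.{w} (Σ i : ℕ, ZMod (Nat.nth Nat.Prime i))

/-- The successor on the disjoint union of cycles. -/
noncomputable def PrimeCycles.succ (x : PrimeCycles.{w}) : PrimeCycles.{w} :=
  ⟨⟨x.down.1, x.down.2 + 1⟩⟩

theorem PrimeCycles.succ_iterate (i : ℕ) (x : ZMod (Nat.nth Nat.Prime i)) (k : ℕ) :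
    PrimeCycles.succ^[k] ⟨⟨i, x⟩⟩ = ⟨⟨i, x + k⟩⟩ := by
  induction k with
  | zero => simp
  | succ k ih => rw [iterate_succ_apply', ih, PrimeCycles.succ]; push_cast; simp only [add_assoc]

/-- Constants denote a chosen element, the other operations are the successor of the first
argument, and the predicates are empty. -/
noncomputable instance PrimeCycles.structure : Ω.Structure PrimeCycles.{w} where
  funMap := fun {k} _ => match k with
    | 0 => fun _ => ⟨⟨0, 0⟩⟩
    | _ + 1 => fun x => (x 0).succ
  RelMap := fun _ _ => False

variable (f) in
theorem exists_model_with_buttons : ∃ A : OmegaModel.{u, v, w} Ω,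
    IsPrimeCyclic f A ∧ pushedButtons f A = ∅ := by
  have hper : ∀ i (x : ZMod (Nat.nth Nat.Prime i)),
      IsPeriodicPt (diagonal f (A := PrimeCycles.{w})) (Nat.nth Nat.Prime i) ⟨⟨i, x⟩⟩ := by
    intro i x
    refine (PrimeCycles.succ_iterate i x _).trans ?_
    simp
  let A : OmegaModel.{u, v, w} Ω := { Carrier := PrimeCycles.{w}, nonempty' := ⟨⟨⟨0, 0⟩⟩⟩ }
  refine ⟨A, ⟨fun _ _ => rfl, fun x => ⟨x.down.1, hper x.down.1 x.down.2⟩⟩, ?_⟩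
  refine Set.eq_empty_of_forall_notMem fun i hi => ?_
  have h : PrimeCycles.succ.{w} ⟨⟨i, 0⟩⟩ = ⟨⟨i, 0⟩⟩ := hi _ (hper i 0)
  have : Fact (1 < Nat.nth Nat.Prime i) := ⟨(Nat.prime_nth_prime i).one_lt⟩
  simp [PrimeCycles.succ] at h

end Buttons

/-! ### Completeness of S4.2.1 -/

section Completeness

variable {Ω : FirstOrder.Language.{u, v}} {n : ℕ} (f : Ω.Functions (n + 1))
  (lab : ℕ → WorldS421)

open WorldS421 CanonicalWorld

open Classical in
/-- The point assigned to a set of buttons: the label of the last one if the labels of the buttons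
increase, and the greatest point otherwise. -/
noncomputable def worldOfButtons (S : Set ℕ) : WorldS421 :=
  if S.Finite ∧ ∀ i ∈ S, ∀ j ∈ S, i ≤ j → (lab i).Sees (lab j) then lab (sSup S) else (lab 0).top

variable {lab}

/-- If the labels of T increase, so do those of S, and both last buttons lie in T. Otherwise T is
sent to `top`, seen by everything above `lab 0`. -/
theorem sees_worldOfButtons (hlab : ∀ i, (lab 0).Sees (lab i)) {S T : Set ℕ} (hS : S.Nonempty)
    (hST : S ⊆ T) : (worldOfButtons lab S).Sees (worldOfButtons lab T) := by
  by_cases hT : T.Finite ∧ ∀ i ∈ T, ∀ j ∈ T, i ≤ j → (lab i).Sees (lab j)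
  · rw [worldOfButtons, worldOfButtons, if_pos hT, if_pos
      ⟨hT.1.subset hST, fun i hi j hj => hT.2 i (hST hi) j (hST hj)⟩]
    exact hT.2 _ (hST (Nat.sSup_mem hS (hT.1.subset hST).bddAbove)) _
      (Nat.sSup_mem (hS.mono hST) hT.1.bddAbove) (csSup_le_csSup hT.1.bddAbove hS hST)
  · rw [worldOfButtons, worldOfButtons, if_neg hT]
    split_ifs
    · exact sees_top (hlab _)
    · exact sees_refl _

/-- In the increasing case a witness can be chosen beyond all of S, so inserting it keeps the labels
increasing and makes it last. In the other case `top` sees only itself. -/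
theorem exists_insert_worldOfButtons
    (hlab : ∀ (i : ℕ) (ψ : MF) (m : ℕ), dia ψ ∈ (lab i).carrier →
      ∃ j, m < j ∧ (lab i).Sees (lab j) ∧ ψ ∈ (lab j).carrier) {S : Set ℕ} (hS : S.Nonempty)
    {ψ : MF} (hψ : dia ψ ∈ (worldOfButtons lab S).carrier) :
    ψ ∈ (worldOfButtons lab S).carrier ∨
      ∃ i, ψ ∈ (worldOfButtons lab (insert i S)).carrier := by
  by_cases h : S.Finite ∧ ∀ i ∈ S, ∀ j ∈ S, i ≤ j → (lab i).Sees (lab j)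
  · right
    rw [worldOfButtons, if_pos h] at hψ
    obtain ⟨j, hj, hsees, hmem⟩ := hlab _ ψ (sSup S) hψ
    have hlt : ∀ i ∈ S, i < j := fun i hi => (le_csSup h.1.bddAbove hi).trans_lt hj
    have hsup : sSup (insert j S) = j := by
      rw [csSup_insert h.1.bddAbove hS]
      exact max_eq_left hj.le
    refine ⟨j, ?_⟩
    rw [worldOfButtons, if_pos, hsup]
    · exact hmem
    · refine ⟨h.1.insert j, ?_⟩
      rintro i (rfl | hi) k (rfl | hk) hik
      · exact sees_refl _
      · exact absurd (hlt k hk) hik.not_gt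
      · exact sees_trans (h.2 i hi _ (Nat.sSup_mem hS h.1.bddAbove)
          (le_csSup h.1.bddAbove hi)) hsees
      · exact h.2 i hi k hk hik
  · left
    rw [worldOfButtons, if_neg h] at hψ ⊢
    obtain ⟨v, hv, hvψ⟩ := (dia_mem_iff _ ψ).1 hψ
    rwa [eq_top_of_sees hv] at hvψ

/-- The point of the canonical model assigned to a model. -/
noncomputable def worldOfModel (lab : ℕ → WorldS421) (A : OmegaModel.{u, v, w} Ω) : WorldS421 :=
  -- Button 0 always counts as pushed: the set is nonempty, and a model without pushed buttons gets
  -- `lab 0`.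
  worldOfButtons lab (insert 0 (pushedButtons f A))

variable {f}

/-- The truth lemma; the induction stays within prime cyclic models because these are closed under
quotients. -/
theorem diaSat_subst_iff (h₀ : ∀ i, (lab 0).Sees (lab i))
    (hlab : ∀ (i : ℕ) (ψ : MF) (m : ℕ), dia ψ ∈ (lab i).carrier →
      ∃ j, m < j ∧ (lab i).Sees (lab j) ∧ ψ ∈ (lab j).carrier)
    (K : ModelLanguage.{u, v, w} Ω) (val : ℕ → K.DiaSentence)
    (hval : ∀ A i, K.DiaSat Set.univ QuotientRel A (val i) ↔
      ModalFormula.var i ∈ (worldOfModel f lab A).carrier)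
    (ψ : MF) {A : OmegaModel.{u, v, w} Ω} (hA : IsPrimeCyclic f A) :
    K.DiaSat Set.univ QuotientRel A (ψ.subst val) ↔ ψ ∈ (worldOfModel f lab A).carrier := by
  induction ψ generalizing A with
  | var i => exact hval A i
  | bot => exact iff_of_false id (worldOfModel f lab A).bot_notMem
  | imp φ ψ ih₁ ih₂ =>
    rw [imp_mem, ← ih₁ hA, ← ih₂ hA]
    rfl
  | dia ψ ih =>
    constructor
    · rintro ⟨B, -, hAB, hψ⟩
      obtain ⟨π, hπ⟩ := quotientRel_iff.1 hAB
      exact sees_worldOfButtons h₀ (Set.insert_nonempty _ _)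
        (Set.insert_subset_insert (hπ.pushedButtons_subset hA)) ψ
        ((ih (hπ.isPrimeCyclic hA)).1 hψ)
    · intro h
      rcases exists_insert_worldOfButtons hlab (Set.insert_nonempty _ _) h with h | ⟨i, hi⟩
      · exact ⟨A, trivial, .refl A, (ih hA).2 h⟩
      · obtain ⟨B, hAB, hB⟩ := exists_push_button hA i
        obtain ⟨π, hπ⟩ := quotientRel_iff.1 hAB
        refine ⟨B, trivial, hAB, (ih (hπ.isPrimeCyclic hA)).2 ?_⟩
        rwa [worldOfModel, hB, Set.insert_comm]

theorem exists_refuting_properties (f : Ω.Functions (n + 1)) {φ : MF} (hφ : φ ∉ logicS421) :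
    ∃ P : ℕ → OmegaModel.{u, v, w} Ω → Prop,
      (∀ i (A B : OmegaModel.{u, v, w} Ω), Nonempty (A ≃[Ω] B) → P i A → P i B) ∧
      ∀ (K : ModelLanguage.{u, v, w} Ω) (val : ℕ → K.DiaSentence),
        (∀ A i, K.DiaSat Set.univ QuotientRel A (val i) ↔ P i A) →
          φ ∉ K.MTh Set.univ QuotientRel := by
  obtain ⟨w₀, hw₀⟩ := exists_world_of_notMem_logicS421 hφ
  obtain ⟨lab, rfl, h₀, hlab⟩ := w₀.exists_labelling
  refine ⟨fun i A => ModalFormula.var i ∈ (worldOfModel f lab A).carrier, ?_, ?_⟩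
  · rintro i A B ⟨e⟩ h
    rwa [worldOfModel, pushedButtons_eq_of_equiv e] at h
  · intro K val hval hmem
    obtain ⟨A, hA, hempty⟩ := exists_model_with_buttons.{u, v, w} f
    have h := (diaSat_subst_iff h₀ hlab K val hval φ hA).1 (hmem val A trivial)
    rw [worldOfModel, hempty, worldOfButtons, if_pos] at h
    · simp at h
      exact hw₀ h
    · simpa using sees_refl (lab 0)

/-- Every language can be extended so that its modal theory is included in `S4.2.1`. -/
theorem exists_sub_MTh_subset (f : Ω.Functions (n + 1)) (L : ModelLanguage.{u, v, w} Ω) :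
    ∃ K : ModelLanguage.{u, v, w} Ω, L.Sub K ∧ K.MTh Set.univ QuotientRel ⊆ logicS421 := by
  choose P hP hrefute using fun φ : {φ : MF // φ ∉ logicS421} =>
    exists_refuting_properties.{u, v, w} f φ.2
  -- The properties for all non-theorems are added at once, so a single K refutes each of them.
  refine ⟨L.extend (fun i : {φ : MF // φ ∉ logicS421} × ℕ => P i.1 i.2) fun i => hP i.1 i.2,
    L.sub_extend _ _, fun φ hφ => ?_⟩
  by_contra hn
  exact hrefute ⟨φ, hn⟩ _ (fun i => .var (ModelLanguage.ImpComb.atom (.inr (⟨φ, hn⟩, i))))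
    (fun _ _ => Iff.rfl) hφ

end Completeness

/-! ### The robust theory -/

theorem mainTheorem5 (Ω : FirstOrder.Language.{u, v})
    (hΩ : ∃ n : ℕ, 1 ≤ n ∧ Nonempty (Ω.Functions n)) :
    IsRobustTheory (Set.univ : Set (OmegaModel.{u, v, w} Ω)) QuotientRel logicS421 := by
  obtain ⟨n, hn, ⟨f⟩⟩ := hΩ
  obtain ⟨n, rfl⟩ := Nat.exists_eq_add_of_le' hn
  constructor
  · obtain ⟨L, -, hL⟩ := exists_sub_MTh_subset.{u, v, w} f (ModelLanguage.firstOrder Ω)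
    -- For K ⊇ L the theory of K is squeezed: S4.2.1 ⊆ MTh(K) ⊆ MTh(L) ⊆ S4.2.1.
    exact ⟨L, fun K hLK => (ModelLanguage.MTh_subset_of_sub hLK _ _).antisymm
      (hL.trans K.logicS421_subset_MTh)⟩
  · intro L hL
    obtain ⟨K, hLK, hK⟩ := exists_sub_MTh_subset.{u, v, w} f L
    rw [← hL K hLK]
    exact hK.antisymm K.logicS421_subset_MTh
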